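/- A curve in $\mathbb{R}^d$ is given by a continuous map $f:[0,1]\to\mathbb{R}^d$ (up to reparametrization); write $\mathcal{C}$ for its image, and assume that $\mathcal{C}$ is not a single point. Fix a macroscopic scale $L_o>0$ and a shrinkage factor $\gamma>1$, and put $L_k=\gamma^{-k}L_o$ for $k=0,1,2,\dots$. A *straight run* of the curve at scale $L=L_k$ is a segment $f([a,b])$, $0\le a\le b\le 1$, with $|f(a)-f(b)|=L$, which is contained in the closed solid circular cylinder of length $L$ and cross-sectional diameter $(9/\sqrt{\gamma})\,L$ whose two faces are centred at $f(a)$ and $f(b)$. A collection of straight runs at scales $L_{k_1}>\dots>L_{k_n}$ is *nested* if, for any two of its runs, the cylinder of the run at the larger scale contains the other run. For an integer $k_o\ge 0$, the straight runs of the curve are *$(\gamma,k_o)$-sparse* (with macroscopic scale $L_o$) if the curve does not exhibit any nested collection of straight runs on a sequence of scales $L_{k_1}>\dots>L_{k_n}$, $n\ge 1$, with $n\ge\frac12\max\{k_n,k_o\}$. **Theorem.** Let the curve be as above. 1. If its straight runs are $(\gamma,k_o)$-sparse, for some $L_o>0$ and some integer $k_o\ge0$, and $m\ge 1$ is an integer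 strictly smaller than $\gamma$, then $\dim_{\mathcal H}\mathcal{C}\ge s$, where $s$ is given by $\gamma^s=\sqrt{m(m+1)}$. 2. In particular, if $m\ge 2$ is an integer such that for every $\gamma>m$ there are $L_o>0$ and an integer $k_o\ge0$ (both may depend on $\gamma$) for which the straight runs of the curve are $(\gamma,k_o)$-sparse, then $$\dim_{\mathcal H}\mathcal{C}\ \ge\ 1+\frac{\ln(1+1/m)}{2\ln m}.$$ -/

import Mathlib

/-- The closed solid right circular cylinder in `ℝ^d` whose two faces are centred at `x` and `y`
(so its length is `dist x y`) and whose cross sections have diameter `w`: the points `p` that lie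
at distance at most `w / 2` from a point `c` of the axis segment `[x, y]`, in the direction
orthogonal to the axis. -/
def cylinder {d : ℕ} (x y : EuclideanSpace ℝ (Fin d)) (w : ℝ) :
    Set (EuclideanSpace ℝ (Fin d)) :=
  {p | ∃ c ∈ segment ℝ x y, inner ℝ (p - c) (y - x) = 0 ∧ dist p c ≤ w / 2}

/-- The length scale `L_k = γ^{-k} L₀`. -/
noncomputable def lengthScale (γ L₀ : ℝ) (k : ℕ) : ℝ := L₀ / γ ^ k

/-- The cylinder that belongs to a straight run at scale `L` from the point `f a` to the point
`f b` of the curve: faces centred at these two points, cross sectional diameter `(9 / √γ) L`. -/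
noncomputable def runCylinder {d : ℕ} (f : C(unitInterval, EuclideanSpace ℝ (Fin d)))
    (γ L : ℝ) (a b : unitInterval) : Set (EuclideanSpace ℝ (Fin d)) :=
  cylinder (f a) (f b) (9 / √γ * L)

/-- The segment of the curve `f` between the parameters `a ≤ b` is a straight run at scale `L`:
it traverses, in the length direction and joining the centres of the two faces, a cylinder of
length `L` and cross sectional diameter `(9 / √γ) L`.
Reparametrizing or reversing `f` does not change which segments are straight runs. -/
def IsStraightRun {d : ℕ} (f : C(unitInterval, EuclideanSpace ℝ (Fin d)))
    (γ L : ℝ) (a b : unitInterval) : Prop :=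
  a ≤ b ∧ dist (f a) (f b) = L ∧ f '' Set.Icc a b ⊆ runCylinder f γ L a b

/-- `f` exhibits a nested collection of straight runs at the scales `L_{k 0} > ⋯ > L_{k n}`
(`n + 1` runs): of any two of the runs, the cylinder of the one at the larger scale
contains the other run. -/
def ExhibitsNestedRuns {d : ℕ} (f : C(unitInterval, EuclideanSpace ℝ (Fin d)))
    (γ L₀ : ℝ) {n : ℕ} (k : Fin (n + 1) → ℕ) : Prop :=
  ∃ a b : Fin (n + 1) → unitInterval,
    (∀ i, IsStraightRun f γ (lengthScale γ L₀ (k i)) (a i) (b i)) ∧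
    ∀ i j, i < j →
      f '' Set.Icc (a j) (b j) ⊆ runCylinder f γ (lengthScale γ L₀ (k i)) (a i) (b i)

/-- The straight runs of `f` are `(γ, k₀)`-sparse down to the scale `ℓ` (with macroscopic scale
`L₀`): there is no nested collection of straight runs at scales `L_{k 0} > ⋯ > L_{k n}`,
`L_{k n} ≥ ℓ`, whose number `n + 1` is at least `max (k n) k₀ / 2`. -/
def StraightRunsSparseDownTo {d : ℕ} (f : C(unitInterval, EuclideanSpace ℝ (Fin d)))
    (γ L₀ : ℝ) (k₀ : ℕ) (ℓ : ℝ) : Prop :=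
  ∀ (n : ℕ) (k : Fin (n + 1) → ℕ), StrictMono k →
    ℓ ≤ lengthScale γ L₀ (k (Fin.last n)) →
    (1 / 2 : ℝ) * max (k (Fin.last n) : ℝ) (k₀ : ℝ) ≤ (n : ℝ) + 1 →
    ¬ ExhibitsNestedRuns f γ L₀ k

/-- The straight runs of `f` are `(γ, k₀)`-sparse, that is, sparse down to every positive scale. -/
def StraightRunsSparse {d : ℕ} (f : C(unitInterval, EuclideanSpace ℝ (Fin d)))
    (γ L₀ : ℝ) (k₀ : ℕ) : Prop :=
  ∀ ℓ : ℝ, 0 < ℓ → StraightRunsSparseDownTo f γ L₀ k₀ ℓ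

/-!
Call an arc of the curve tight at scale `ℓ` if its diameter is `ℓ` and its end points realize it.
An arc that is tight at scale `γ * ℓ` crosses `m` concentric shells around its starting point, each
slightly thicker than `ℓ`, and each crossing contains an arc tight at scale `ℓ`; arcs from different
shells are a definite fraction of `ℓ` apart. If the tight arc is not a straight run, it leaves the
cylinder spanned by its end points, so by Pythagoras it passes through a point for which the detour
is longer than the chord by a fixed multiple of `ℓ`. Shells in the three mutually tangent balls
around the end points and this point then provide `m + 1` separated subarcs.

Iterating produces a tree of arcs along which mass is divided evenly. By sparsity at most about half
of the first `k` generations of a branch are straight runs, hence arcs of generation `k` carry mass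
at most a constant times `(m * (m + 1)) ^ (-k / 2) = γ ^ (-s * k)`, and the mass distribution
principle bounds the dimension below by `s`.
-/

open Set MeasureTheory
open scoped ENNReal NNReal

section MinimalInterval

variable {T : Type*} [LinearOrder T] [TopologicalSpace T] [OrderClosedTopology T]
  [CompactIccSpace T]

theorem exists_minimal_interval_le {R : T → T → Prop} (hR : IsClosed {p : T × T | R p.1 p.2})
    {J : NonemptyInterval T} (hJ : R J.fst J.snd) :
    ∃ I ≤ J, Minimal (fun I : NonemptyInterval T ↦ R I.fst I.snd) I := by
  set K : Set (T × T) := (Icc J.fst J.snd ×ˢ Icc J.fst J.snd) ∩ {p | p.1 ≤ p.2 ∧ R p.1 p.2}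
  have hK : IsCompact K := (isCompact_Icc.prod isCompact_Icc).inter_right
    ((isClosed_le continuous_fst continuous_snd).inter hR)
  have mem_K {I : NonemptyInterval T} (hIJ : I ≤ J) (hI : R I.fst I.snd) : I.toProd ∈ K :=
    ⟨⟨⟨hIJ.1, I.fst_le_snd.trans hIJ.2⟩, ⟨hIJ.1.trans I.fst_le_snd, hIJ.2⟩⟩, I.fst_le_snd, hI⟩
  obtain ⟨_, ⟨p, hpK, rfl⟩, hp⟩ :=
    (hK.image continuous_snd).exists_isLeast ⟨_, mem_image_of_mem _ (mem_K le_rfl hJ)⟩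
  obtain ⟨_, ⟨q, ⟨hqK, hqp⟩, rfl⟩, hq⟩ :=
    ((hK.inter_right (isClosed_singleton.preimage continuous_snd)).image
      continuous_fst).exists_isGreatest ⟨_, mem_image_of_mem _ ⟨hpK, mem_singleton p.2⟩⟩
  have hqp : q.2 = p.2 := hqp
  have hqJ : (⟨q, hqK.2.1⟩ : NonemptyInterval T) ≤ J := ⟨hqK.1.1.1, hqK.1.2.2⟩
  refine ⟨⟨q, hqK.2.1⟩, hqJ, hqK.2.2, fun I hI hIq ↦ ?_⟩
  have hIK := mem_K (hIq.trans hqJ) hI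
  have hle : q.2 ≤ I.snd := hqp ▸ hp (mem_image_of_mem _ hIK)
  exact ⟨hq ⟨_, ⟨hIK, (hIq.2.antisymm hle).trans hqp⟩, rfl⟩, hle⟩

end MinimalInterval

/-- The arc of the curve `g` over the parameter interval `I` has diameter `ℓ`, attained at its two
end points. -/
structure IsTightArc {T X : Type*} [Preorder T] [PseudoMetricSpace X] (g : T → X) (ℓ : ℝ)
    (I : NonemptyInterval T) : Prop where
  dist_eq : dist (g I.fst) (g I.snd) = ℓ
  dist_le : ∀ u ∈ I, ∀ v ∈ I, dist (g u) (g v) ≤ ℓ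

/-- Points of different members of the family `A` are at distance at least `δ` from each other. -/
def PairwiseSeparated {X ι : Type*} [PseudoMetricSpace X] (δ : ℝ) (A : ι → Set X) : Prop :=
  Pairwise fun i j ↦ ∀ x ∈ A i, ∀ y ∈ A j, δ ≤ dist x y

/-- The intervals `c i` cut out of the arc over `J` subarcs that are tight at scale `ℓ` and
`δ`-separated from each other. -/
structure IsSeparatedSubarcs {T X ι : Type*} [PartialOrder T] [PseudoMetricSpace X] (g : T → X)
    (ℓ δ : ℝ) (J : NonemptyInterval T) (c : ι → NonemptyInterval T) : Prop where
  le : ∀ i, c i ≤ J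
  isTightArc : ∀ i, IsTightArc g ℓ (c i)
  separated : PairwiseSeparated δ fun i ↦ g '' c i

theorem IsSeparatedSubarcs.comp {T X ι κ : Type*} [PartialOrder T] [PseudoMetricSpace X]
    {g : T → X} {ℓ δ : ℝ} {J : NonemptyInterval T} {c : ι → NonemptyInterval T}
    (hc : IsSeparatedSubarcs g ℓ δ J c) (e : κ ↪ ι) : IsSeparatedSubarcs g ℓ δ J (c ∘ e) :=
  ⟨fun i ↦ hc.le (e i), fun i ↦ hc.isTightArc (e i),
    fun _ _ hij ↦ hc.separated (e.injective.ne hij)⟩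

section Arcs

variable {T X : Type*} [ConditionallyCompleteLinearOrder T] [TopologicalSpace T] [OrderTopology T]
  [DenselyOrdered T] [PseudoMetricSpace X] {g : T → X} {J : NonemptyInterval T} {ℓ η : ℝ}

theorem exists_interval_forall_mem_Icc {φ : T → ℝ} (hφ : Continuous φ) {p q : T} (hp : p ∈ J)
    (hq : q ∈ J) {x y : ℝ} (hxy : x ≤ y) (hpx : φ p ≤ x) (hqy : y ≤ φ q) :
    ∃ I ≤ J, dist (φ I.fst) (φ I.snd) = y - x ∧ ∀ u ∈ I, φ u ∈ Icc x y := by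
  wlog hpq : p ≤ q generalizing p q x y φ
  · obtain ⟨I, hIJ, hdist, hI⟩ := this hφ.neg hq hp (neg_le_neg hxy) (neg_le_neg hqy)
      (neg_le_neg hpx) (le_of_not_ge hpq)
    refine ⟨I, hIJ, ?_, fun u hu ↦ ⟨neg_le_neg_iff.1 (hI u hu).2, neg_le_neg_iff.1 (hI u hu).1⟩⟩
    simpa only [Pi.neg_apply, dist_neg_neg, sub_neg_eq_add, neg_add_eq_sub] using hdist
  have hclosed : IsClosed {r : T × T | φ r.1 ≤ x ∧ y ≤ φ r.2} :=
    (isClosed_le (hφ.comp continuous_fst) continuous_const).inter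
      (isClosed_le continuous_const (hφ.comp continuous_snd))
  obtain ⟨I, hIJ, hI⟩ := exists_minimal_interval_le (R := fun u v ↦ φ u ≤ x ∧ y ≤ φ v)
    hclosed (J := ⟨(p, q), hpq⟩) ⟨hpx, hqy⟩
  have hrange : ∀ u ∈ I, φ u ∈ Icc x y := by
    refine fun u hu ↦ ⟨?_, ?_⟩ <;> by_contra! hlt
    · obtain ⟨v, hv, rfl⟩ := intermediate_value_Icc hu.2 hφ.continuousOn
        ⟨hlt.le, hxy.trans hI.prop.2⟩
      have hIv := hI.le_of_le (y := ⟨(v, I.snd), hv.2⟩) ⟨le_rfl, hI.prop.2⟩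
        ⟨hu.1.trans hv.1, le_rfl⟩
      exact hlt.ne (congrArg φ (hv.1.antisymm (hIv.1.trans hu.1)))
    · obtain ⟨v, hv, rfl⟩ := intermediate_value_Icc hu.1 hφ.continuousOn
        ⟨hI.prop.1.trans hxy, hlt.le⟩
      have hIv := hI.le_of_le (y := ⟨(I.fst, v), hv.1⟩) ⟨hI.prop.1, le_rfl⟩
        ⟨le_rfl, hv.2.trans hu.2⟩
      exact hlt.ne (congrArg φ (hv.2.antisymm (hu.2.trans hIv.2)))
  have hfst : φ I.fst = x := hI.prop.1.antisymm (hrange _ ⟨le_rfl, I.fst_le_snd⟩).1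
  have hsnd : φ I.snd = y := (hrange _ ⟨I.fst_le_snd, le_rfl⟩).2.antisymm hI.prop.2
  refine ⟨I, hIJ.trans ⟨hp.1, hq.2⟩, ?_, hrange⟩
  rw [hfst, hsnd, dist_comm, Real.dist_eq, abs_of_nonneg (sub_nonneg.2 hxy)]

theorem exists_isTightArc_le (hg : Continuous g) (hℓ : 0 ≤ ℓ)
    (hJ : ℓ ≤ dist (g J.fst) (g J.snd)) : ∃ I ≤ J, IsTightArc g ℓ I := by
  obtain ⟨I, hIJ, hI⟩ := exists_minimal_interval_le (R := fun u v ↦ ℓ ≤ dist (g u) (g v))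
    (isClosed_le continuous_const (by fun_prop)) hJ
  have hdist : dist (g I.fst) (g I.snd) = ℓ := by
    obtain ⟨v, hv, hℓv⟩ := intermediate_value_Icc I.fst_le_snd
      (f := fun v ↦ dist (g I.fst) (g v)) (by fun_prop) ⟨(dist_self (g I.fst)).trans_le hℓ, hI.prop⟩
    have hIv := hI.le_of_le (y := ⟨(I.fst, v), hv.1⟩) hℓv.ge ⟨le_rfl, hv.2⟩
    rwa [hv.2.antisymm hIv.2] at hℓv
  refine ⟨I, hIJ, hdist, fun u hu v hv ↦ ?_⟩
  wlog huv : u ≤ v generalizing u v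
  · exact dist_comm (g u) (g v) ▸ this v hv u hu (le_of_not_ge huv)
  by_contra! hlt
  have hIuv := hI.le_of_le (y := ⟨(u, v), huv⟩) hlt.le ⟨hu.1, hv.2⟩
  rw [hu.1.antisymm' hIuv.1, hv.2.antisymm hIuv.2] at hlt
  exact hlt.ne' hdist

theorem exists_isTightArc_le_in_shell (hg : Continuous g) {p q : T} (hp : p ∈ J) (hq : q ∈ J)
    {ρ : ℝ} (hℓ : 0 ≤ ℓ) (hρ : 0 ≤ ρ) (hpq : ρ + ℓ ≤ dist (g q) (g p)) :
    ∃ I ≤ J, IsTightArc g ℓ I ∧ ∀ u ∈ I, dist (g u) (g p) ∈ Icc ρ (ρ + ℓ) := by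
  obtain ⟨I, hIJ, hdist, hI⟩ := exists_interval_forall_mem_Icc (φ := fun u ↦ dist (g u) (g p))
    (by fun_prop) hp hq (le_add_of_nonneg_right hℓ) ((dist_self (g p)).trans_le hρ) hpq
  obtain ⟨I', hI'I, htight⟩ := exists_isTightArc_le hg hℓ (J := I) <| by
    rw [add_sub_cancel_left] at hdist
    exact hdist ▸ abs_dist_sub_le _ _ _
  exact ⟨I', hI'I.trans hIJ, htight, fun u hu ↦ hI u ⟨hI'I.1.trans hu.1, hu.2.trans hI'I.2⟩⟩

theorem exists_separatedSubarcs_in_ball (hg : Continuous g) {p q : T} (hp : p ∈ J) (hq : q ∈ J)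
    (hℓ : 0 ≤ ℓ) (hη : 0 ≤ η) {N : ℕ} (hN : N * ((1 + η) * ℓ) ≤ dist (g q) (g p)) :
    ∃ c : Fin N → NonemptyInterval T, IsSeparatedSubarcs g ℓ (η * ℓ) J c ∧
      ∀ i, ∀ u ∈ c i, dist (g u) (g p) + η * ℓ ≤ N * ((1 + η) * ℓ) := by
  have hηℓ : 0 ≤ η * ℓ := mul_nonneg hη hℓ
  have hw : 0 ≤ (1 + η) * ℓ := by positivity
  have shell_le {i j : ℕ} (hij : i < j) :
      i * ((1 + η) * ℓ) + ℓ + η * ℓ ≤ j * ((1 + η) * ℓ) := by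
    have hij : (i + 1 : ℝ) ≤ j := mod_cast hij
    linarith [mul_le_mul_of_nonneg_right hij hw]
  choose c hcJ hc hshell using fun i : Fin N ↦ exists_isTightArc_le_in_shell hg hp hq
    hℓ (show 0 ≤ i * ((1 + η) * ℓ) by positivity) (by linarith [shell_le i.2])
  refine ⟨c, ⟨hcJ, hc, ?_⟩, fun i u hu ↦ by linarith [(hshell i u hu).2, shell_le i.2]⟩
  rintro i j hij _ ⟨u, hu, rfl⟩ _ ⟨v, hv, rfl⟩
  wlog hlt : i < j generalizing i j u v
  · exact dist_comm (g u) (g v) ▸ this hij.symm v hv u hu (hij.lt_or_gt.resolve_left hlt)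
  have htri := dist_triangle_left (g v) (g p) (g u)
  linarith [(hshell i u hu).2, (hshell j v hv).1, shell_le hlt]

theorem IsTightArc.exists_separatedSubarcs (hg : Continuous g) {γ : ℝ}
    (hJ : IsTightArc g (γ * ℓ) J) (hℓ : 0 ≤ ℓ) (hη : 0 ≤ η) {m : ℕ} (hm : m * (1 + η) ≤ γ) :
    ∃ c : Fin m → NonemptyInterval T, IsSeparatedSubarcs g ℓ (η * ℓ) J c := by
  obtain ⟨c, hc, -⟩ := exists_separatedSubarcs_in_ball hg
    (p := J.fst) (q := J.snd) ⟨le_rfl, J.fst_le_snd⟩ ⟨J.fst_le_snd, le_rfl⟩ hℓ hη (N := m) <| by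
      rw [dist_comm, hJ.dist_eq, ← mul_assoc]
      gcongr
  exact ⟨c, hc⟩

theorem exists_separatedSubarcs_in_balls (hg : Continuous g) {ι : Type*} [Fintype ι] {p q : ι → T}
    (hp : ∀ i, p i ∈ J) (hq : ∀ i, q i ∈ J) {r : ι → ℝ}
    (hdisj : Pairwise fun i j ↦ r i + r j ≤ dist (g (p i)) (g (p j)))
    (hr : ∀ i, r i ≤ dist (g (q i)) (g (p i))) (hℓ : 0 ≤ ℓ) (hη : 0 ≤ η) {n : ι → ℕ}
    (hn : ∀ i, n i * ((1 + η) * ℓ) ≤ r i) {N : ℕ} (hN : N ≤ ∑ i, n i) :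
    ∃ c : Fin N → NonemptyInterval T, IsSeparatedSubarcs g ℓ (η * ℓ) J c := by
  have hηℓ : 0 ≤ η * ℓ := mul_nonneg hη hℓ
  choose c hc hball using fun i ↦
    exists_separatedSubarcs_in_ball hg (hp i) (hq i) hℓ hη ((hn i).trans (hr i))
  have hall : IsSeparatedSubarcs g ℓ (η * ℓ) J fun x : Σ i, Fin (n i) ↦ c x.1 x.2 := by
    refine ⟨fun x ↦ (hc x.1).le x.2, fun x ↦ (hc x.1).isTightArc x.2, ?_⟩
    rintro ⟨i, k⟩ ⟨j, l⟩ hne _ ⟨u, hu, rfl⟩ _ ⟨v, hv, rfl⟩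
    obtain rfl | hij := eq_or_ne i j
    · have hkl : k ≠ l := fun h ↦ hne (congrArg _ h)
      exact (hc i).separated hkl _ (mem_image_of_mem g hu) _ (mem_image_of_mem g hv)
    · have htri := dist_triangle4 (g (p i)) (g u) (g v) (g (p j))
      rw [dist_comm (g (p i)) (g u)] at htri
      linarith [hdisj hij, hn i, hn j, hball i k u hu, hball j l v hv]
  obtain ⟨e⟩ : Nonempty (Fin N ↪ Σ i, Fin (n i)) :=
    Function.Embedding.nonempty_of_card_le (by simpa using hN)
  exact ⟨_, hall.comp e⟩

theorem le_sum_floor_of_add_card_le {ι : Type*} [Fintype ι] [Nonempty ι] {N : ℕ} {a : ι → ℝ}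
    (h : N + Fintype.card ι ≤ ∑ i, a i + 1) : N ≤ ∑ i, ⌊a i⌋₊ := by
  have hlt : ∑ i, a i < ∑ i, ((⌊a i⌋₊ : ℝ) + 1) :=
    Finset.sum_lt_sum_of_nonempty Finset.univ_nonempty fun _ _ ↦ Nat.lt_floor_add_one _
  simp only [Finset.sum_add_distrib, Finset.sum_const, Finset.card_univ, nsmul_one] at hlt
  have hlt : (N : ℝ) < (∑ i, ⌊a i⌋₊ : ℕ) + 1 := by
    push_cast
    linarith
  exact Nat.lt_succ_iff.1 (mod_cast hlt)

/-- The three balls are the mutually tangent ones centred at the vertices of the triangle. Rounding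
down the number of shells in each of them costs less than three subarcs. -/
theorem exists_separatedSubarcs_of_le_half_perimeter (hg : Continuous g) {p q r : T} (hp : p ∈ J)
    (hq : q ∈ J) (hr : r ∈ J) (hℓ : 0 < ℓ) (hη : 0 ≤ η) {N : ℕ}
    (hN : (N + 2) * ((1 + η) * ℓ) ≤
      (dist (g p) (g q) + dist (g q) (g r) + dist (g r) (g p)) / 2) :
    ∃ c : Fin N → NonemptyInterval T, IsSeparatedSubarcs g ℓ (η * ℓ) J c := by
  set x := dist (g q) (g r)
  set y := dist (g r) (g p)
  set z := dist (g p) (g q)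
  have hx' : dist (g r) (g q) = x := dist_comm _ _
  have hy' : dist (g p) (g r) = y := dist_comm _ _
  have hz' : dist (g q) (g p) = z := dist_comm _ _
  have hxyz : x ≤ y + z := by linarith [dist_triangle (g q) (g p) (g r)]
  have hyzx : y ≤ z + x := by linarith [dist_triangle (g r) (g q) (g p)]
  have hzxy : z ≤ x + y := by linarith [dist_triangle (g p) (g r) (g q)]
  have hw : 0 < (1 + η) * ℓ := by positivity
  set a : Fin 3 → ℝ := ![(y + z - x) / 2, (z + x - y) / 2, (x + y - z) / 2]
  have ha : ∀ i, 0 ≤ a i := by intro i; fin_cases i <;> simp [a] <;> linarith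
  refine exists_separatedSubarcs_in_balls hg (p := ![p, q, r]) (q := ![q, r, p]) (r := a)
    (by simp [Fin.forall_fin_succ, *]) (by simp [Fin.forall_fin_succ, *]) ?_ ?_ hℓ.le hη
    (n := fun i ↦ ⌊a i / ((1 + η) * ℓ)⌋₊) (fun i ↦ ?_) ?_
  · intro i j hij
    fin_cases i <;> fin_cases j <;> simp [a, *] at hij ⊢ <;> linarith
  · intro i
    fin_cases i <;> simp [a, *] <;> linarith
  · exact (le_div_iff₀ hw).1 (Nat.floor_le (div_nonneg (ha i) hw.le))
  · refine le_sum_floor_of_add_card_le ?_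
    rw [← Finset.sum_div, div_add_one hw.ne', le_div_iff₀ hw, Fin.sum_univ_three]
    simp only [a, Fintype.card_fin, Matrix.cons_val]
    push_cast
    linarith

end Arcs

section Lens

variable {E : Type*} [NormedAddCommGroup E] [InnerProductSpace ℝ E] {p x y c : E}

theorem dist_add_dist_sq_div_le_of_inner_eq_zero {L : ℝ} (hL : 0 < L)
    (hc : inner ℝ (p - c) (c - x) = 0) (hpL : dist x p ≤ L) :
    dist x c + dist p c ^ 2 / (2 * L) ≤ dist x p := by
  have hpyth : dist x p ^ 2 = dist x c ^ 2 + dist p c ^ 2 := by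
    rw [dist_comm x p, dist_comm x c, dist_eq_norm p x, dist_eq_norm c x, dist_eq_norm p c,
      ← sub_add_sub_cancel p c x, norm_add_sq_real, hc]
    ring
  have hle : dist x c ≤ dist x p :=
    le_of_sq_le_sq (by linarith [sq_nonneg (dist p c)]) dist_nonneg
  have hdiv : dist p c ^ 2 / (2 * L) ≤ dist x p - dist x c := by
    rw [div_le_iff₀ (by positivity)]
    nlinarith [dist_nonneg (x := x) (y := c)]
  linarith

theorem dist_add_dist_sq_div_le_of_mem_segment (hxy : 0 < dist x y) (hc : c ∈ segment ℝ x y)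
    (hpc : inner ℝ (p - c) (y - x) = 0) (hxp : dist x p ≤ dist x y) (hpy : dist p y ≤ dist x y) :
    dist x y + dist p c ^ 2 / dist x y ≤ dist x p + dist p y := by
  have inner_eq_zero (t : ℝ) : inner ℝ (p - c) (t • (y - x)) = 0 := by
    rw [inner_smul_right, hpc, mul_zero]
  obtain ⟨t, -, rfl⟩ := (segment_eq_image' ℝ x y ▸ hc :)
  have hxc := dist_add_dist_sq_div_le_of_inner_eq_zero (c := x + t • (y - x)) hxy
    (by simpa only [add_sub_cancel_left] using inner_eq_zero t) hxp
  have hyc := dist_add_dist_sq_div_le_of_inner_eq_zero (x := y) (c := x + t • (y - x)) hxy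
    (by convert inner_eq_zero (t - 1) using 2; module) (dist_comm p y ▸ hpy)
  have hsum := dist_add_dist_of_mem_segment hc
  have hhalf (a : ℝ) : a / dist x y = a / (2 * dist x y) + a / (2 * dist x y) := by
    field_simp
    norm_num
  rw [hhalf]
  linarith [dist_comm (x + t • (y - x)) y, dist_comm p y]

theorem exists_mem_segment_inner_eq_zero (hxp : dist x p ≤ dist x y) (hpy : dist p y ≤ dist x y) :
    ∃ c ∈ segment ℝ x y, inner ℝ (p - c) (y - x) = 0 := by
  rw [dist_comm x p, dist_comm x y, dist_eq_norm, dist_eq_norm] at hxp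
  rw [dist_comm x y, dist_eq_norm, dist_eq_norm, ← sub_sub_sub_cancel_right p y x] at hpy
  have hle : inner ℝ (p - x) (y - x) ≤ ‖y - x‖ ^ 2 :=
    (real_inner_le_norm _ _).trans <| by rw [sq]; gcongr
  have hnonneg : 0 ≤ inner ℝ (p - x) (y - x) := by
    have hsq := pow_le_pow_left₀ (norm_nonneg _) hpy 2
    rw [norm_sub_sq_real] at hsq
    nlinarith [sq_nonneg ‖p - x‖]
  refine ⟨x + (inner ℝ (p - x) (y - x) / ‖y - x‖ ^ 2) • (y - x), ?_, ?_⟩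
  · rw [segment_eq_image']
    exact mem_image_of_mem _ ⟨by positivity, div_le_one_of_le₀ hle (by positivity)⟩
  · rw [← sub_sub, inner_sub_left, real_inner_smul_left, real_inner_self_eq_norm_sq]
    obtain hyx | hyx := eq_or_ne (y - x) 0
    · simp [hyx]
    · rw [div_mul_cancel₀ _ (by simpa using hyx), sub_self]

end Lens

theorem add_le_dist_add_dist_of_notMem_cylinder {d : ℕ} {p x y : EuclideanSpace ℝ (Fin d)} {w : ℝ}
    (hxy : 0 < dist x y) (hw : 0 ≤ w) (hxp : dist x p ≤ dist x y) (hpy : dist p y ≤ dist x y)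
    (hp : p ∉ cylinder x y w) :
    dist x y + w ^ 2 / (4 * dist x y) ≤ dist x p + dist p y := by
  obtain ⟨c, hc, hpc⟩ := exists_mem_segment_inner_eq_zero hxp hpy
  have hwc : w / 2 < dist p c := by
    by_contra! hle
    exact hp ⟨c, hc, hpc, hle⟩
  calc dist x y + w ^ 2 / (4 * dist x y) = dist x y + (w / 2) ^ 2 / dist x y := by
        field_simp
        ring
    _ ≤ dist x y + dist p c ^ 2 / dist x y := by gcongr
    _ ≤ dist x p + dist p y := dist_add_dist_sq_div_le_of_mem_segment hxy hc hpc hxp hpy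

section Branching

variable {d : ℕ} {f : C(unitInterval, EuclideanSpace ℝ (Fin d))} {γ η ℓ : ℝ}
  {J : NonemptyInterval unitInterval}

theorem IsTightArc.exists_detour {L : ℝ} (hJ : IsTightArc f L J) (hγ : 0 < γ) (hL : 0 < L)
    (hrun : ¬ IsStraightRun f γ L J.fst J.snd) :
    ∃ u ∈ J, L + 81 / (4 * γ) * L ≤ dist (f J.fst) (f u) + dist (f u) (f J.snd) := by
  have hnot : ¬ f '' Icc J.fst J.snd ⊆ runCylinder f γ L J.fst J.snd :=
    fun hsub ↦ hrun ⟨J.fst_le_snd, hJ.dist_eq, hsub⟩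
  obtain ⟨_, ⟨u, hu, rfl⟩, hmem⟩ := not_subset.1 hnot
  refine ⟨u, hu, ?_⟩
  have hdetour := add_le_dist_add_dist_of_notMem_cylinder (hJ.dist_eq.symm ▸ hL)
    (by positivity) (by rw [hJ.dist_eq]; exact hJ.dist_le _ ⟨le_rfl, J.fst_le_snd⟩ _ hu)
    (by rw [hJ.dist_eq]; exact hJ.dist_le _ hu _ ⟨J.fst_le_snd, le_rfl⟩) hmem
  rw [hJ.dist_eq, mul_pow, div_pow, Real.sq_sqrt hγ.le] at hdetour
  refine Eq.trans_le ?_ hdetour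
  field_simp
  norm_num

theorem IsTightArc.exists_separatedSubarcs_of_not_isStraightRun (hJ : IsTightArc f (γ * ℓ) J)
    (hγ : 0 < γ) (hℓ : 0 < ℓ) (hη : 0 ≤ η) (hη1 : η ≤ 1) {m : ℕ} (hm : m * (1 + η) ≤ γ)
    (hrun : ¬ IsStraightRun f γ (γ * ℓ) J.fst J.snd) :
    ∃ c : Fin (m + 1) → NonemptyInterval unitInterval, IsSeparatedSubarcs f ℓ (η * ℓ) J c := by
  obtain ⟨u, hu, hdetour⟩ := hJ.exists_detour hγ (by positivity) hrun
  refine exists_separatedSubarcs_of_le_half_perimeter f.continuous (p := J.fst) (q := u)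
    (r := J.snd) ⟨le_rfl, J.fst_le_snd⟩ hu ⟨J.fst_le_snd, le_rfl⟩ hℓ hη ?_
  -- The detour lengthens the half perimeter by `81 / 8 * ℓ`, which pays for three extra shells.
  have hexcess : 81 / (4 * γ) * (γ * ℓ) = 81 / 4 * ℓ := by field_simp
  have hshells : (m + 3) * (1 + η) * ℓ ≤ (γ + 6) * ℓ := by gcongr; linarith
  rw [dist_comm (f J.snd), hJ.dist_eq]
  push_cast
  linarith

end Branching

section Covers

theorem exists_isOpen_superset_ediam_lt_rpow_le {X : Type*} [PseudoEMetricSpace X] {t : Set X}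
    (ht : Metric.ediam t ≠ ⊤) {s : ℝ} {ε : ℝ≥0∞} (hε : ε ≠ 0) (hs : 0 ≤ s) :
    ∃ V ⊇ t, IsOpen V ∧ ∃ r : ℝ≥0, Metric.ediam V < r ∧
      (r ^ s : ℝ≥0) ≤ Metric.ediam t ^ s + ε := by
  lift Metric.ediam t to ℝ≥0 using ht with D hD
  have hcont : Continuous fun δ : ℝ≥0 ↦ (((D + 3 * δ) ^ s : ℝ≥0) : ℝ≥0∞) :=
    ENNReal.continuous_coe.comp ((NNReal.continuous_rpow_const hs).comp (by fun_prop))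
  have hlt : (((D + 3 * 0) ^ s : ℝ≥0) : ℝ≥0∞) < (D : ℝ≥0∞) ^ s + ε := by
    rw [mul_zero, add_zero, ENNReal.coe_rpow_of_nonneg _ hs]
    exact ENNReal.lt_add_right (by finiteness) hε
  obtain ⟨δ, hδ, hδlt⟩ := ((hcont.tendsto 0).eventually (gt_mem_nhds hlt)).exists_gt
  refine ⟨Metric.thickening δ t, Metric.self_subset_thickening (NNReal.coe_pos.2 hδ) t,
    Metric.isOpen_thickening, D + 3 * δ, ?_, hδlt.le⟩
  calc Metric.ediam (Metric.thickening δ t) ≤ (D + 2 * δ : ℝ≥0) := by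
        simpa [hD] using Metric.ediam_thickening_le δ
    _ < (D + 3 * δ : ℝ≥0) := by
        rw [ENNReal.coe_lt_coe]
        gcongr
        norm_num

theorem exists_countable_cover_tsum_ediam_rpow_lt {X : Type*} [EMetricSpace X] {K : Set X} {s : ℝ≥0}
    (hs : 0 < s) (hK : dimH K < s) {ε : ℝ≥0∞} (hε : ε ≠ 0) :
    ∃ t : ℕ → Set X, K ⊆ ⋃ n, t n ∧ (∀ n, Metric.ediam (t n) ≠ ⊤) ∧
      ∑' n, Metric.ediam (t n) ^ (s : ℝ) < ε := by
  borelize X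
  have hzero := hausdorffMeasure_of_dimH_lt hK
  rw [Measure.hausdorffMeasure_apply] at hzero
  have hlt := (iSup₂_le_iff.1 hzero.le 1 one_pos).trans_lt (pos_iff_ne_zero.2 hε)
  simp only [iInf_lt_iff] at hlt
  obtain ⟨t, hKt, ht, hsum⟩ := hlt
  refine ⟨t, hKt, fun n ↦ ne_top_of_le_ne_top ENNReal.one_ne_top (ht n), ?_⟩
  convert hsum using 3 with n
  obtain hn | hn := (t n).eq_empty_or_nonempty
  · simp [hn, hs]
  · simp [hn]

theorem exists_finite_cover_sum_rpow_lt {X : Type*} [EMetricSpace X] {K : Set X}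
    (hK : IsCompact K) {s : ℝ≥0} (hs : 0 < s) (hKs : dimH K < s) {κ : ℝ≥0} (hκ : 0 < κ) :
    ∃ (T : Finset ℕ) (U : ℕ → Set X) (r : ℕ → ℝ≥0), K ⊆ ⋃ n ∈ T, U n ∧
      (∀ n, Metric.ediam (U n) < r n) ∧ ∑ n ∈ T, r n ^ (s : ℝ) < κ := by
  have hκ2 : ((κ / 2 : ℝ≥0) : ℝ≥0∞) ≠ 0 := by positivity
  obtain ⟨t, hKt, ht, htsum⟩ := exists_countable_cover_tsum_ediam_rpow_lt hs hKs hκ2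
  obtain ⟨ε, hε, hεsum⟩ := ENNReal.exists_pos_sum_of_countable hκ2 ℕ
  choose U htU hU r hUr hr using fun n ↦ exists_isOpen_superset_ediam_lt_rpow_le (ht n)
    (ENNReal.coe_ne_zero.2 (hε n).ne') s.coe_nonneg
  obtain ⟨T, hT⟩ := hK.elim_finite_subcover U hU (hKt.trans (iUnion_mono htU))
  refine ⟨T, U, r, hT, hUr, ENNReal.coe_lt_coe.1 ?_⟩
  calc ((∑ n ∈ T, r n ^ (s : ℝ) : ℝ≥0) : ℝ≥0∞)
      ≤ ∑ n ∈ T, (Metric.ediam (t n) ^ (s : ℝ) + ε n) := by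
        rw [ENNReal.ofNNReal_finsetSum]
        exact Finset.sum_le_sum fun n _ ↦ hr n
    _ ≤ ∑' n, Metric.ediam (t n) ^ (s : ℝ) + ∑' n, (ε n : ℝ≥0∞) := by
        rw [← ENNReal.tsum_add]
        exact ENNReal.sum_le_tsum _
    _ < (κ / 2 : ℝ≥0) + (κ / 2 : ℝ≥0) := ENNReal.add_lt_add htsum hεsum
    _ = κ := by rw [← ENNReal.coe_add, add_halves]

end Covers

section MassDistribution

section PseudoMetric

variable {X κ : Type*} [PseudoMetricSpace X] {A K : Set X} {T : Finset κ} {U : κ → Set X}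

open scoped Classical in
theorem PairwiseSeparated.sum_sum_le {ι : Type*} [Fintype ι] {δ : ℝ} {c : ι → Set X}
    (hc : PairwiseSeparated δ c) (hcA : ∀ i, c i ⊆ A)
    (hU : ∀ n ∈ T, (U n ∩ A).Nonempty → ∀ x ∈ U n, ∀ y ∈ U n, dist x y < δ) {b : κ → ℝ}
    (hb : ∀ n, 0 ≤ b n) :
    ∑ i, ∑ n ∈ T with (U n ∩ c i).Nonempty, b n ≤ ∑ n ∈ T with (U n ∩ A).Nonempty, b n := by
  have meets_of_meets_subset {n : κ} {i : ι} (h : (U n ∩ c i).Nonempty) : (U n ∩ A).Nonempty :=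
    h.mono (inter_subset_inter_right _ (hcA i))
  rw [← Finset.sum_biUnion]
  · refine Finset.sum_le_sum_of_subset_of_nonneg (fun n hn ↦ ?_) fun n _ _ ↦ hb n
    obtain ⟨i, -, hni⟩ := Finset.mem_biUnion.1 hn
    obtain ⟨hnT, hmeets⟩ := Finset.mem_filter.1 hni
    exact Finset.mem_filter.2 ⟨hnT, meets_of_meets_subset hmeets⟩
  · refine fun i _ j _ hij ↦ Finset.disjoint_left.2 fun n hni hnj ↦ ?_
    obtain ⟨hnT, x, hxU, hxi⟩ := Finset.mem_filter.1 hni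
    obtain ⟨-, y, hyU, hyj⟩ := Finset.mem_filter.1 hnj
    exact (hc hij x hxi y hyj).not_gt (hU n hnT (meets_of_meets_subset ⟨x, hxU, hxi⟩) x hxU y hyU)

/-- A branching family of cells of a set `K`, for use in the mass distribution principle: `P k w A`
means that `A` is a cell of generation `k` which carries the mass `w`. The mass of a cell of
generation `k` is at most `B k`, and it can be handed on to cells of the next generation that are
`δ (k + 1)`-separated. A cell may carry several masses and may be split in several ways, so no mass
has to be chosen coherently. -/
structure IsMassTree (P : ℕ → ℝ → Set X → Prop) (δ B : ℕ → ℝ) (K : Set X) : Prop where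
  nonempty : ∀ {k w A}, P k w A → (A ∩ K).Nonempty
  mass_le : ∀ {k w A}, P k w A → w ≤ B k
  branch : ∀ {k w A}, P k w A → ∃ (N : ℕ) (c : Fin N → Set X) (v : Fin N → ℝ),
    w ≤ ∑ i, v i ∧ (∀ i, P (k + 1) (v i) (c i)) ∧ (∀ i, c i ⊆ A) ∧ PairwiseSeparated (δ (k + 1)) c

namespace IsMassTree

variable {P : ℕ → ℝ → Set X → Prop} {δ B : ℕ → ℝ} {k : ℕ} {w : ℝ}

/- A cell met by a covering set of a coarser generation is paid for by that set alone. Otherwise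
every covering set that meets the cell is so small that it meets only one of its children. -/
open scoped Classical in
theorem mass_le_sum (hP : IsMassTree P δ B K) (hδ : Antitone δ) (hB : Antitone B)
    (hB0 : ∀ k, 0 ≤ B k) (hKU : K ⊆ ⋃ n ∈ T, U n) {q : κ → ℕ}
    (hU : ∀ n ∈ T, ∀ x ∈ U n, ∀ y ∈ U n, dist x y < δ (q n)) (hA : P k w A) :
    w ≤ ∑ n ∈ T with (U n ∩ A).Nonempty, B (q n) := by
  have le_of_coarse {k w A} (hA : P k w A) (h : ∃ n ∈ T, (U n ∩ A).Nonempty ∧ q n ≤ k) :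
      w ≤ ∑ n ∈ T with (U n ∩ A).Nonempty, B (q n) := by
    obtain ⟨n, hnT, hnA, hqk⟩ := h
    exact (hP.mass_le hA).trans <| (hB hqk).trans <|
      Finset.single_le_sum (f := fun n ↦ B (q n)) (fun i _ ↦ hB0 (q i))
        (Finset.mem_filter.2 ⟨hnT, hnA⟩)
  obtain ⟨j, hj⟩ : ∃ j, T.sup q ≤ k + j := ⟨T.sup q, Nat.le_add_left _ _⟩
  induction j generalizing k w A with
  | zero =>
    obtain ⟨x, hxA, hxK⟩ := hP.nonempty hA
    obtain ⟨n, hnT, hxU⟩ := mem_iUnion₂.1 (hKU hxK)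
    exact le_of_coarse hA ⟨n, hnT, ⟨x, hxU, hxA⟩, (Finset.le_sup hnT).trans hj⟩
  | succ j ih =>
    by_cases hcoarse : ∃ n ∈ T, (U n ∩ A).Nonempty ∧ q n ≤ k
    · exact le_of_coarse hA hcoarse
    · push Not at hcoarse
      obtain ⟨N, c, v, hwv, hc, hcA, hsep⟩ := hP.branch hA
      calc w ≤ ∑ i, v i := hwv
        _ ≤ ∑ i, ∑ n ∈ T with (U n ∩ c i).Nonempty, B (q n) :=
          Finset.sum_le_sum fun i _ ↦ ih (hc i) (by lia)
        _ ≤ ∑ n ∈ T with (U n ∩ A).Nonempty, B (q n) :=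
          hsep.sum_sum_le hcA (fun n hn hnA x hx y hy ↦
            (hU n hn x hx y hy).trans_le (hδ (hcoarse n hn hnA))) fun n ↦ hB0 (q n)

end IsMassTree

theorem exists_nat_le_div_pow {γ a ρ s : ℝ} (hγ : 1 < γ) (hρ : 0 < ρ) (hρa : ρ ≤ a) (hs : 0 ≤ s) :
    ∃ q : ℕ, ρ ≤ a / γ ^ q ∧ 1 / (γ ^ s) ^ q ≤ γ ^ s * (ρ / a) ^ s := by
  have hγ0 : 0 < γ := one_pos.trans hγ
  have ha : 0 < a := hρ.trans_le hρa
  obtain ⟨q, hq, hq'⟩ := exists_nat_pow_near ((one_le_div hρ).2 hρa) hγ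
  refine ⟨q, (le_div_comm₀ (by positivity) hρ).1 hq, ?_⟩
  have hle : 1 ≤ γ ^ (q + 1) * (ρ / a) := by
    rw [div_lt_iff₀ hρ] at hq'
    rw [mul_div_assoc', one_le_div ha]
    exact hq'.le
  rw [div_le_iff₀ (by positivity)]
  calc (1 : ℝ) ≤ (γ ^ (q + 1) * (ρ / a)) ^ s := Real.one_le_rpow hle hs
    _ = (γ ^ s) ^ (q + 1) * (ρ / a) ^ s := by
      rw [Real.mul_rpow (by positivity) (by positivity), Real.rpow_pow_comm hγ0.le]
    _ = γ ^ s * (ρ / a) ^ s * (γ ^ s) ^ q := by ring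

theorem antitone_div_pow {a x : ℝ} (ha : 0 ≤ a) (hx : 1 ≤ x) : Antitone fun k : ℕ ↦ a / x ^ k :=
  fun _ _ hkl ↦ div_le_div_of_nonneg_left ha (by positivity) (pow_le_pow_right₀ hx hkl)

namespace IsMassTree

variable {P : ℕ → ℝ → Set X → Prop} {γ a b s w : ℝ} {k : ℕ}

theorem mass_le_sum_rpow (hγ : 1 < γ) (hb : 0 ≤ b) (hs : 0 ≤ s)
    (hP : IsMassTree P (fun k ↦ a / γ ^ k) (fun k ↦ b / (γ ^ s) ^ k) K) (hA : P k w A)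
    (hKU : K ⊆ ⋃ n ∈ T, U n) {ρ : κ → ℝ}
    (hρ : ∀ n ∈ T, 0 < ρ n ∧ ρ n ≤ a) (hU : ∀ n ∈ T, ∀ x ∈ U n, ∀ y ∈ U n, dist x y < ρ n) :
    w ≤ b * γ ^ s / a ^ s * ∑ n ∈ T, ρ n ^ s := by
  classical
  have hγs : 1 ≤ γ ^ s := Real.one_le_rpow hγ.le hs
  choose! q hρq hq using fun n hn ↦ exists_nat_le_div_pow hγ (hρ n hn).1 (hρ n hn).2 hs
  have ha : 0 ≤ a := by
    obtain ⟨x, -, hxK⟩ := hP.nonempty hA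
    obtain ⟨n, hnT, -⟩ := mem_iUnion₂.1 (hKU hxK)
    exact (hρ n hnT).1.le.trans (hρ n hnT).2
  calc w ≤ ∑ n ∈ T with (U n ∩ A).Nonempty, b / (γ ^ s) ^ q n :=
        hP.mass_le_sum (antitone_div_pow ha hγ.le) (antitone_div_pow hb hγs)
          (fun k ↦ by positivity) hKU (fun n hn x hx y hy ↦ (hU n hn x hx y hy).trans_le (hρq n hn))
          hA
    _ ≤ ∑ n ∈ T, b / (γ ^ s) ^ q n :=
        Finset.sum_le_sum_of_subset_of_nonneg (Finset.filter_subset _ _) fun _ _ _ ↦ by positivity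
    _ ≤ ∑ n ∈ T, b * (γ ^ s * (ρ n / a) ^ s) :=
        Finset.sum_le_sum fun n hn ↦ by
          rw [← mul_one_div]
          exact mul_le_mul_of_nonneg_left (hq n hn) hb
    _ = b * γ ^ s / a ^ s * ∑ n ∈ T, ρ n ^ s := by
        rw [Finset.mul_sum]
        refine Finset.sum_congr rfl fun n hn ↦ ?_
        rw [Real.div_rpow (hρ n hn).1.le ha]
        ring

end IsMassTree

end PseudoMetric

theorem IsMassTree.ofReal_le_dimH {X : Type*} [MetricSpace X] {A K : Set X}
    {P : ℕ → ℝ → Set X → Prop} {γ a b s w : ℝ} {k : ℕ} (hγ : 1 < γ) (ha : 0 < a) (hK : IsCompact K)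
    (hP : IsMassTree P (fun k ↦ a / γ ^ k) (fun k ↦ b / (γ ^ s) ^ k) K) (hA : P k w A)
    (hw : 0 < w) : ENNReal.ofReal s ≤ dimH K := by
  by_contra! hlt
  have hs : 0 < s := ENNReal.ofReal_pos.1 (pos_of_gt hlt)
  have hb : 0 < b := (div_pos_iff_of_pos_right (by positivity)).1 (hw.trans_le (hP.mass_le hA))
  set κ : ℝ := min (a ^ s) (w / (b * γ ^ s / a ^ s))
  have hκ : 0 < κ := by positivity
  obtain ⟨T, U, r, hKU, hUr, hsum⟩ := exists_finite_cover_sum_rpow_lt hK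
    (Real.toNNReal_pos.2 hs) hlt (Real.toNNReal_pos.2 hκ)
  rw [Real.coe_toNNReal s hs.le, ← NNReal.coe_lt_coe, Real.coe_toNNReal κ hκ.le] at hsum
  push_cast at hsum
  have hr (n) : (0 : ℝ) < r n := NNReal.coe_pos.2 (ENNReal.coe_pos.1 (pos_of_gt (hUr n)))
  have hra : ∀ n ∈ T, (r n : ℝ) ≤ a := fun n hn ↦ by
    refine (Real.rpow_le_rpow_iff (hr n).le ha.le hs).1 ?_
    exact (Finset.single_le_sum (f := fun n ↦ (r n : ℝ) ^ s) (fun i _ ↦ by positivity) hn).trans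
      (hsum.le.trans (min_le_left _ _))
  have hle := hP.mass_le_sum_rpow hγ hb.le hs.le hA hKU (fun n hn ↦ ⟨hr n, hra n hn⟩)
    fun n _ x hx y hy ↦ edist_lt_coe.1 ((Metric.edist_le_ediam_of_mem hx hy).trans_lt (hUr n))
  have hlt := (lt_div_iff₀' (by positivity)).1 (hsum.trans_le (min_le_right _ _))
  exact hlt.not_ge hle

end MassDistribution

section SparseRuns

theorem lengthScale_pos {γ L₀ : ℝ} (hγ : 0 < γ) (hL₀ : 0 < L₀) (k : ℕ) : 0 < lengthScale γ L₀ k :=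
  div_pos hL₀ (pow_pos hγ k)

theorem lengthScale_eq_mul_succ {γ : ℝ} (hγ : γ ≠ 0) (L₀ : ℝ) (k : ℕ) :
    lengthScale γ L₀ k = γ * lengthScale γ L₀ (k + 1) := by
  rw [lengthScale, lengthScale, pow_succ]
  field_simp

variable {d : ℕ} {f : C(unitInterval, EuclideanSpace ℝ (Fin d))} {γ L₀ η : ℝ} {k k₀ m n : ℕ}
  {I J : NonemptyInterval unitInterval}

/-- The parameter interval `I` is contained in a decreasing chain of `n` parameter intervals that
are straight runs of `f` at distinct scales `L_i` with `i < k`; the chain assigns `A i` to the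
scale `L_i`. -/
def HasRunsAbove (f : C(unitInterval, EuclideanSpace ℝ (Fin d))) (γ L₀ : ℝ) (n k : ℕ)
    (I : NonemptyInterval unitInterval) : Prop :=
  ∃ (S : Finset ℕ) (A : ℕ → NonemptyInterval unitInterval), S.card = n ∧ AntitoneOn A S ∧
    ∀ i ∈ S, i < k ∧ I ≤ A i ∧ IsStraightRun f γ (lengthScale γ L₀ i) (A i).fst (A i).snd

theorem hasRunsAbove_zero (f : C(unitInterval, EuclideanSpace ℝ (Fin d))) (γ L₀ : ℝ) (k : ℕ)
    (I : NonemptyInterval unitInterval) : HasRunsAbove f γ L₀ 0 k I :=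
  ⟨∅, fun _ ↦ I, by simp [AntitoneOn]⟩

theorem HasRunsAbove.succ_of_le (h : HasRunsAbove f γ L₀ n k J) (hIJ : I ≤ J) :
    HasRunsAbove f γ L₀ n (k + 1) I := by
  obtain ⟨S, A, hcard, hA, hS⟩ := h
  exact ⟨S, A, hcard, hA, fun i hi ↦
    ⟨(hS i hi).1.trans k.lt_succ_self, hIJ.trans (hS i hi).2.1, (hS i hi).2.2⟩⟩

theorem HasRunsAbove.succ_of_isStraightRun (h : HasRunsAbove f γ L₀ n k J) (hIJ : I ≤ J)
    (hJ : IsStraightRun f γ (lengthScale γ L₀ k) J.fst J.snd) :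
    HasRunsAbove f γ L₀ (n + 1) (k + 1) I := by
  obtain ⟨S, A, hcard, hA, hS⟩ := h
  have hkS : k ∉ S := fun hk ↦ (hS k hk).1.false
  have update_eq : ∀ i ∈ S, Function.update A k J i = A i := fun i hi ↦
    Function.update_of_ne (hS i hi).1.ne J A
  refine ⟨insert k S, Function.update A k J,
    by rw [Finset.card_insert_of_notMem hkS, hcard], ?_, ?_⟩
  · rw [Finset.coe_insert]
    rintro i (rfl | hi) j (rfl | hj) hij
    · exact le_rfl
    · exact absurd hij (hS j hj).1.not_ge
    · rw [update_eq i hi, Function.update_self]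
      exact (hS i hi).2.1
    · rw [update_eq i hi, update_eq j hj]
      exact hA hi hj hij
  · intro i hi
    obtain rfl | hi := Finset.mem_insert.1 hi
    · rw [Function.update_self]
      exact ⟨i.lt_succ_self, hIJ, hJ⟩
    · rw [update_eq i hi]
      exact ⟨(hS i hi).1.trans k.lt_succ_self, hIJ.trans (hS i hi).2.1, (hS i hi).2.2⟩

theorem StraightRunsSparse.two_mul_le (hf : StraightRunsSparse f γ L₀ k₀) (hγ : 0 < γ)
    (hL₀ : 0 < L₀) (h : HasRunsAbove f γ L₀ n k I) : 2 * n ≤ k + k₀ := by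
  obtain ⟨S, A, hcard, hA, hS⟩ := h
  obtain _ | n := n
  · exact Nat.zero_le _
  by_contra! hlt
  set κ := S.orderEmbOfFin hcard
  have hκ (i) : κ i ∈ S := S.orderEmbOfFin_mem hcard i
  refine hf _ (lengthScale_pos hγ hL₀ (κ (Fin.last n))) n κ κ.strictMono le_rfl ?_
    ⟨fun i ↦ (A (κ i)).fst, fun i ↦ (A (κ i)).snd, fun i ↦ (hS _ (hκ i)).2.2, fun i j hij ↦ ?_⟩
  · have hlast : max (κ (Fin.last n)) k₀ ≤ 2 * (n + 1) := by
      have := (hS _ (hκ (Fin.last n))).1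
      lia
    have hlast : max (κ (Fin.last n) : ℝ) k₀ ≤ 2 * (n + 1) := mod_cast hlast
    linarith
  · have hle : A (κ j) ≤ A (κ i) := hA (hκ i) (hκ j) (κ.strictMono hij).le
    exact (image_mono (Icc_subset_Icc hle.1 hle.2)).trans (hS _ (hκ i)).2.2.2.2

/-- The mass of a cell of generation `k` that lies below `n` straight runs: a straight run splits
its mass among `m` children, every other arc among `m + 1`. -/
noncomputable def runMass (m : ℝ) (k n : ℕ) : ℝ := ((m + 1) / m) ^ n / (m + 1) ^ k

theorem runMass_pos {m : ℝ} (hm : 0 < m) (k n : ℕ) : 0 < runMass m k n := by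
  rw [runMass]
  positivity

theorem mul_runMass_succ_succ {m : ℝ} (hm : 0 < m) (k n : ℕ) :
    m * runMass m (k + 1) (n + 1) = runMass m k n := by
  rw [runMass, runMass, pow_succ, pow_succ]
  field_simp

theorem mul_runMass_succ {m : ℝ} (hm : 0 < m) (k n : ℕ) :
    (m + 1) * runMass m (k + 1) n = runMass m k n := by
  rw [runMass, runMass, pow_succ]
  field_simp

theorem runMass_le {m : ℝ} (hm : 0 < m) (h : 2 * n ≤ k + k₀) :
    runMass m k n ≤ √((m + 1) / m) ^ k₀ / √(m * (m + 1)) ^ k := by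
  set x := √((m + 1) / m)
  set y := √(m * (m + 1))
  have hx : x ^ 2 = (m + 1) / m := Real.sq_sqrt (by positivity)
  have hx1 : 1 ≤ x := Real.one_le_sqrt.2 ((one_le_div hm).2 (by linarith))
  have hxy : x * y = m + 1 := by
    rw [← Real.sqrt_mul (by positivity), Real.sqrt_eq_iff_mul_self_eq] <;> try positivity
    field_simp
  calc runMass m k n = x ^ (2 * n) / (x * y) ^ k := by rw [runMass, pow_mul, hx, hxy]
    _ ≤ x ^ (k + k₀) / (x * y) ^ k := by gcongr
    _ = x ^ k₀ / y ^ k := by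
      rw [pow_add, mul_pow]
      field_simp

/-- The cells of the mass tree of a curve: `A` is a tight arc of diameter `L_k`, and its mass counts
the straight runs in a chain above it. -/
def IsArcCell (f : C(unitInterval, EuclideanSpace ℝ (Fin d))) (γ L₀ : ℝ) (m k : ℕ) (w : ℝ)
    (A : Set (EuclideanSpace ℝ (Fin d))) : Prop :=
  ∃ I n, IsTightArc f (lengthScale γ L₀ k) I ∧ HasRunsAbove f γ L₀ n k I ∧
    w = runMass m k n ∧ A = f '' I

theorem IsTightArc.exists_children (hJ : IsTightArc f (lengthScale γ L₀ k) J)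
    (h : HasRunsAbove f γ L₀ n k J) (hL₀ : 0 < L₀) (hm : 0 < m) (hη : 0 ≤ η) (hη1 : η ≤ 1)
    (hmγ : m * (1 + η) ≤ γ) :
    ∃ (N n' : ℕ) (c : Fin N → NonemptyInterval unitInterval),
      IsSeparatedSubarcs f (lengthScale γ L₀ (k + 1)) (η * lengthScale γ L₀ (k + 1)) J c ∧
      (∀ i, HasRunsAbove f γ L₀ n' (k + 1) (c i)) ∧
      N * runMass m (k + 1) n' = runMass m k n := by
  have hm' : (0 : ℝ) < m := Nat.cast_pos.2 hm
  have hγ : 0 < γ := (by positivity : 0 < m * (1 + η)).trans_le hmγ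
  have hL := lengthScale_pos hγ hL₀ (k + 1)
  have hJ' := lengthScale_eq_mul_succ hγ.ne' L₀ k ▸ hJ
  by_cases hrun : IsStraightRun f γ (lengthScale γ L₀ k) J.fst J.snd
  · obtain ⟨c, hc⟩ := hJ'.exists_separatedSubarcs f.continuous hL.le hη hmγ
    exact ⟨m, n + 1, c, hc, fun i ↦ h.succ_of_isStraightRun (hc.le i) hrun,
      mul_runMass_succ_succ hm' k n⟩
  · rw [lengthScale_eq_mul_succ hγ.ne'] at hrun
    obtain ⟨c, hc⟩ := hJ'.exists_separatedSubarcs_of_not_isStraightRun hγ hL hη hη1 hmγ hrun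
    exact ⟨m + 1, n, c, hc, fun i ↦ h.succ_of_le (hc.le i), by
      rw [Nat.cast_add_one, mul_runMass_succ hm']⟩

theorem StraightRunsSparse.isMassTree (hf : StraightRunsSparse f γ L₀ k₀) (hL₀ : 0 < L₀)
    (hm : 0 < m) (hη : 0 ≤ η) (hη1 : η ≤ 1) (hmγ : m * (1 + η) ≤ γ) :
    IsMassTree (IsArcCell f γ L₀ m) (fun k ↦ η * L₀ / γ ^ k)
      (fun k ↦ √((m + 1 : ℝ) / m) ^ k₀ / √(m * (m + 1)) ^ k) (range f) where
  nonempty := by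
    rintro k _ _ ⟨I, n, -, -, rfl, rfl⟩
    exact ⟨f I.fst, mem_image_of_mem f ⟨le_rfl, I.fst_le_snd⟩, mem_range_self _⟩
  mass_le := by
    rintro k _ _ ⟨I, n, -, hI, rfl, -⟩
    have hm' : (0 : ℝ) < m := Nat.cast_pos.2 hm
    exact runMass_le hm' (hf.two_mul_le ((by positivity : 0 < m * (1 + η)).trans_le hmγ) hL₀ hI)
  branch := by
    rintro k _ _ ⟨J, n, hJ, h, rfl, rfl⟩
    obtain ⟨N, n', c, hc, hruns, hmass⟩ := hJ.exists_children h hL₀ hm hη hη1 hmγ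
    refine ⟨N, fun i ↦ f '' c i, fun _ ↦ runMass m (k + 1) n', ?_,
      fun i ↦ ⟨c i, n', hc.isTightArc i, hruns i, rfl, rfl⟩,
      fun i ↦ image_mono (NonemptyInterval.coe_subset_coe.2 (hc.le i)), ?_⟩
    · simp only [Finset.sum_const, Finset.card_fin, nsmul_eq_mul, hmass, le_refl]
    · simpa only [lengthScale, mul_div_assoc] using hc.separated

theorem exists_isTightArc_lengthScale (hf : (range f).Nontrivial) (hγ : 1 < γ) (hL₀ : 0 < L₀) :
    ∃ k I, IsTightArc f (lengthScale γ L₀ k) I := by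
  obtain ⟨_, ⟨x, rfl⟩, _, ⟨y, rfl⟩, hxy⟩ := hf
  wlog hle : x ≤ y generalizing x y
  · exact this y x hxy.symm (le_of_not_ge hle)
  have hdist := dist_pos.2 hxy
  obtain ⟨k, hk⟩ := pow_unbounded_of_one_lt (L₀ / dist (f x) (f y)) hγ
  have hk' : lengthScale γ L₀ k ≤ dist (f x) (f y) :=
    (div_le_comm₀ (by positivity) hdist).2 hk.le
  obtain ⟨I, -, hI⟩ := exists_isTightArc_le f.continuous
    (lengthScale_pos (by positivity) hL₀ k).le (J := ⟨(x, y), hle⟩) hk'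
  exact ⟨k, I, hI⟩

theorem exists_pos_mul_one_add_le {x y : ℝ} (hx : 0 < x) (hxy : x < y) :
    ∃ η, 0 < η ∧ η ≤ 1 ∧ x * (1 + η) ≤ y := by
  refine ⟨min 1 ((y - x) / x), lt_min one_pos (div_pos (sub_pos.2 hxy) hx), min_le_left _ _, ?_⟩
  calc x * (1 + min 1 ((y - x) / x)) ≤ x * (1 + (y - x) / x) := by gcongr; exact min_le_right _ _
    _ = y := by field_simp; ring

theorem StraightRunsSparse.ofReal_le_dimH (hsparse : StraightRunsSparse f γ L₀ k₀)
    (hf : (range f).Nontrivial) (hL₀ : 0 < L₀) (hm : 0 < m) (hmγ : m < γ) {s : ℝ}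
    (hs : γ ^ s = √(m * (m + 1))) : ENNReal.ofReal s ≤ dimH (range f) := by
  have hm1 : (1 : ℝ) ≤ m := Nat.one_le_cast.2 hm
  have hγ : 1 < γ := hm1.trans_lt hmγ
  obtain ⟨η, hη, hη1, hηγ⟩ := exists_pos_mul_one_add_le (one_pos.trans_le hm1) hmγ
  have htree := hsparse.isMassTree hL₀ hm hη.le hη1 hηγ
  rw [← hs] at htree
  obtain ⟨k, I, hI⟩ := exists_isTightArc_lengthScale hf hγ hL₀
  exact htree.ofReal_le_dimH hγ (mul_pos hη hL₀) (isCompact_range f.continuous)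
    ⟨I, 0, hI, hasRunsAbove_zero f γ L₀ k I, rfl, rfl⟩ (runMass_pos (one_pos.trans_le hm1) k 0)

end SparseRuns

theorem ofReal_logb_le_of_forall_gt {b x : ℝ} (hb : 1 < b) {D : ℝ≥0∞}
    (h : ∀ γ > b, ENNReal.ofReal (Real.logb γ x) ≤ D) : ENNReal.ofReal (Real.logb b x) ≤ D := by
  have hlog : ContinuousAt (fun γ ↦ Real.logb γ x) b :=
    continuousAt_const.div (Real.continuousAt_log (by positivity)) (Real.log_pos hb).ne'
  exact le_of_tendsto
    ((ENNReal.continuous_ofReal.tendsto _).comp (hlog.tendsto.mono_left nhdsWithin_le_nhds))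
    (eventually_nhdsWithin_of_forall (s := Ioi b) h)

theorem logb_sqrt_mul_add_one {x : ℝ} (hx : 1 < x) :
    Real.logb x √(x * (x + 1)) = 1 + Real.log (1 + 1 / x) / (2 * Real.log x) := by
  have hlog := Real.log_pos hx
  have hx1 : x + 1 = x * (1 + 1 / x) := by field_simp
  rw [Real.logb, Real.log_sqrt (by positivity), hx1, Real.log_mul (by positivity) (by positivity),
    Real.log_mul (by positivity) (by positivity)]
  field_simp
  ring

theorem mainTheorem4 (d : ℕ) (f : C(unitInterval, EuclideanSpace ℝ (Fin d)))
    (hf : (Set.range f).Nontrivial) :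
    (∀ (γ L₀ : ℝ) (k₀ m : ℕ) (s : ℝ), 0 < L₀ → 0 < m → (m : ℝ) < γ →
      γ ^ s = √((m : ℝ) * ((m : ℝ) + 1)) →
      StraightRunsSparse f γ L₀ k₀ →
      ENNReal.ofReal s ≤ dimH (Set.range f)) ∧
    (∀ m : ℕ, 2 ≤ m →
      (∀ γ : ℝ, (m : ℝ) < γ → ∃ L₀ : ℝ, 0 < L₀ ∧ ∃ k₀ : ℕ, StraightRunsSparse f γ L₀ k₀) →
      ENNReal.ofReal (1 + Real.log (1 + 1 / (m : ℝ)) / (2 * Real.log (m : ℝ))) ≤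
        dimH (Set.range f)) := by
  refine ⟨fun γ L₀ k₀ m s hL₀ hm hmγ hs hsparse ↦ hsparse.ofReal_le_dimH hf hL₀ hm hmγ hs,
    fun m hm hsparse ↦ ?_⟩
  have hm1 : (1 : ℝ) < m := Nat.one_lt_cast.2 hm
  rw [← logb_sqrt_mul_add_one hm1]
  refine ofReal_logb_le_of_forall_gt hm1 fun γ hγ ↦ ?_
  obtain ⟨L₀, hL₀, k₀, hsparseγ⟩ := hsparse γ hγ
  exact hsparseγ.ofReal_le_dimH hf hL₀ (by lia) hγ
    (Real.rpow_logb (by linarith) (hm1.trans hγ).ne' (by positivity))
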